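/- Let $M,N\ge 0$ be integers and let $F=(\omega^{jk})_{0\le j,k<N}$, $\omega=e^{-2\pi i/N}$, be the discrete Fourier transform matrix. For $x\in\mathbb C^N$ let $P_x=|Fx|^2\in\mathbb R^N_{\ge 0}$ (componentwise) be its power spectrum. For an ordered basis $\mathbb V=(v_1,\dots,v_N)$ of $\mathbb C^N$ and $S\subset\{1,\dots,N\}$ put $\mathbb L_S=\mathrm{span}(v_i : i\in S)$ and $P_{\mathbb L_S}=\{P_x : x\in\mathbb L_S\}$. A property holds for a generic basis (resp. a generic vector of $\mathbb L_S$) if it holds on a non-empty real Zariski open subset of $GL(N,\mathbb C)$ (resp. of $\mathbb L_S$), where complex coordinates are split into their real and imaginary parts. Consider the following conditions on $\mathbb V$. - (SR1) For all $S$ with $|S|=M$ and all $x,y\in\mathbb L_S$: $P_x=P_y$ if and only if $x=ty$ for some $t\in\mathbb C$ with $|t|=1$. - (SR2) For all distinct $S_1,S_2$ with $|S_1|=|S_2|=M$: $P_{\mathbb L_{S_1}}\cap P_{\mathbb L_{S_2}}=P_{\mathbb L_{S_1}\cap\mathbb L_{S_2}}$. - (SR1g) For all $S$ with $|S|=M$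 and generic $x\in\mathbb L_S$: for every $y\in\mathbb L_S$, $P_x=P_y$ if and only if $x=ty$ for some $t\in\mathbb C$ with $|t|=1$. - (SR2g) For all distinct $S_1,S_2$ with $|S_1|=|S_2|=M$: $P_{\mathbb L_{S_1}}\cap P_{\mathbb L_{S_2}}$ is contained in a proper real-algebraic subset of $P_{\mathbb L_{S_1}}$, that is, some real-algebraic set $Z\subset\mathbb R^N$ contains $P_{\mathbb L_{S_1}}\cap P_{\mathbb L_{S_2}}$ but not $P_{\mathbb L_{S_1}}$. **Theorem.** (i) If $N>4M-3$, then (SR1) and (SR2) hold for a generic basis $\mathbb V$ of $\mathbb C^N$. (ii) If $N>2M-1$, then (SR1g) and (SR2g) hold for a generic basis $\mathbb V$ of $\mathbb C^N$. -/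

import Mathlib

open Matrix

noncomputable section

namespace PowerSpectrum

/-- Real-algebraic subsets of `ℝ^σ`: common zero loci of real polynomials. -/
def IsRealAlgebraic {σ : Type*} (Z : Set (σ → ℝ)) : Prop :=
  ∃ I : Ideal (MvPolynomial σ ℝ), Z = MvPolynomial.zeroLocus ℝ I

/-- A property holds generically on `X` (embedded in `ℝ^σ` by the real coordinates `c`) if it holds
on some non-empty Zariski open subset of `X`, that is, at all points of `X` outside some
real-algebraic set that does not contain `X`. -/
def HoldsGenerically {X σ : Type*} (c : X → σ → ℝ) (Q : X → Prop) : Prop :=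
  ∃ Z : Set (σ → ℝ), IsRealAlgebraic Z ∧ (∃ x, c x ∉ Z) ∧ ∀ x, c x ∉ Z → Q x

/-- The real coordinates (real parts and imaginary parts) of a tuple of complex numbers. -/
def realCoords {ι : Type*} (z : ι → ℂ) : ι ⊕ ι → ℝ :=
  Sum.elim (fun i => (z i).re) (fun i => (z i).im)

/-- Ordered bases of `ℂ^N`. -/
abbrev OrderedBasis (N : ℕ) : Type := Module.Basis (Fin N) ℂ (Fin N → ℂ)

/-- The real coordinates of an ordered basis of `ℂ^N`: the real and imaginary parts of all the
entries of its vectors. This identifies the ordered bases with `GL(N, ℂ)`. -/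
def basisCoords {N : ℕ} (V : OrderedBasis N) : (Fin N × Fin N) ⊕ (Fin N × Fin N) → ℝ :=
  realCoords fun p => V p.1 p.2

/-- The discrete Fourier transform matrix `(ω ^ (j k))_{0 ≤ j, k < N}`, `ω = exp (-2 π i / N)`. -/
def dftMatrix (N : ℕ) : Matrix (Fin N) (Fin N) ℂ :=
  Matrix.of fun j k => Complex.exp (-2 * Real.pi * Complex.I / N) ^ ((j : ℕ) * (k : ℕ))

/-- The power spectrum `|F x|²`, taken componentwise. -/
def powerSpectrum {N : ℕ} (x : Fin N → ℂ) : Fin N → ℝ :=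
  fun k => ‖(dftMatrix N *ᵥ x) k‖ ^ 2

/-- The span `L_S(V)` of the basis vectors with index in `S`. -/
def sparseSpan {N : ℕ} (V : OrderedBasis N) (S : Finset (Fin N)) : Submodule ℂ (Fin N → ℂ) :=
  Submodule.span ℂ (V '' (S : Set (Fin N)))

/-- Equality up to a global phase. -/
def EqUpToPhase {N : ℕ} (x y : Fin N → ℂ) : Prop :=
  ∃ t : ℂ, ‖t‖ = 1 ∧ x = t • y

/-- Condition (SR1) for `M`-sparse vectors. -/
def SR1 {N : ℕ} (M : ℕ) (V : OrderedBasis N) : Prop :=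
  ∀ S : Finset (Fin N), S.card = M → ∀ x ∈ sparseSpan V S, ∀ y ∈ sparseSpan V S,
    (powerSpectrum x = powerSpectrum y ↔ EqUpToPhase x y)

/-- Condition (SR2) for `M`-sparse vectors. -/
def SR2 {N : ℕ} (M : ℕ) (V : OrderedBasis N) : Prop :=
  ∀ S₁ S₂ : Finset (Fin N), S₁ ≠ S₂ → S₁.card = M → S₂.card = M →
    powerSpectrum '' (sparseSpan V S₁ : Set (Fin N → ℂ)) ∩
        powerSpectrum '' (sparseSpan V S₂ : Set (Fin N → ℂ)) =
      powerSpectrum '' ((sparseSpan V S₁ : Set (Fin N → ℂ)) ∩ (sparseSpan V S₂ : Set (Fin N → ℂ)))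

/-- Condition (SR1g): (SR1) for generic `x` in each `L_S(V)` with `|S| = M`. -/
def SR1g {N : ℕ} (M : ℕ) (V : OrderedBasis N) : Prop :=
  ∀ S : Finset (Fin N), S.card = M →
    HoldsGenerically (fun x : sparseSpan V S => realCoords (x : Fin N → ℂ)) fun x =>
      ∀ y ∈ sparseSpan V S,
        (powerSpectrum (x : Fin N → ℂ) = powerSpectrum y ↔ EqUpToPhase (x : Fin N → ℂ) y)

/-- Condition (SR2g): for distinct `S₁`, `S₂` of size `M`, the power spectra shared by
`L_{S₁}(V)` and `L_{S₂}(V)` lie in a proper real-algebraic subset of the set of power spectra of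
vectors of `L_{S₁}(V)`. -/
def SR2g {N : ℕ} (M : ℕ) (V : OrderedBasis N) : Prop :=
  ∀ S₁ S₂ : Finset (Fin N), S₁ ≠ S₂ → S₁.card = M → S₂.card = M →
    ∃ Z : Set (Fin N → ℝ), IsRealAlgebraic Z ∧
      powerSpectrum '' (sparseSpan V S₁ : Set (Fin N → ℂ)) ∩
        powerSpectrum '' (sparseSpan V S₂ : Set (Fin N → ℂ)) ⊆ Z ∧
      ¬ powerSpectrum '' (sparseSpan V S₁ : Set (Fin N → ℂ)) ⊆ Z

end PowerSpectrum

end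

/-! The proof is a dimension count. In coordinates of the basis, with `W` the matrix whose columns
are the Fourier transforms of the basis vectors, `P_x(k) = |∑ a_i W_{k,i}|²`. If `P_x = P_y`, every
row of `W` lies on the real quadric `|a·w|² = |b·w|²`, which is a genuine hypersurface unless `a`
and `b` agree up to a phase. Each of the `N` rows thus loses one real dimension.

For (i), normalise `a` to have an entry 1 and `b` to have a real entry: there are `4M - 3`
parameters, so for `N > 4M - 3` the bad `W` satisfy a nonzero polynomial
(`isThin_unresolved_pairs`). Comparing vectors of two different spans yields (SR1) and (SR2)
together. For (SR1g), `a` is kept as data beside `W`: there are `4M - 1` parameters against `2M +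
N`, and sections of a thin set are thin (`IsThin.sections`). For (SR2g), the spectra of one span
depend on `2M - 1` parameters, so they satisfy a polynomial relation over the entries of the columns
in `S₂`; a column outside `S₂` is free to violate it.

The count itself (`exists_ne_zero_eval_eq_zero`) is done with transcendence degrees: if no
polynomial vanished, the coordinate functions would become algebraically independent in a field,
where each row's relation makes one of its entries redundant. -/

namespace PowerSpectrum

open MvPolynomial Algebra AlgebraicIndependent

/-! ### Counting relations by transcendence degree. -/

section Transcendence

variable {k K : Type*} [Field k] [Field K] [Algebra k K]

/-- If `u` is algebraically independent and every `u i` is algebraic over `k[T]`, then `u` has at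
most as many members as `T`. -/
theorem card_le_encard_of_isAlgebraic {α : Type*} [Fintype α] {u : α → K}
    (hu : AlgebraicIndependent k u) {T : Set K}
    (hT : ∀ i, u i ∈ (matroid k K).closure T) : (Fintype.card α : ℕ∞) ≤ T.encard := by
  have hind : (matroid k K).Indep (Set.range u) := matroid_indep_iff.2 hu.coe_range
  have h1 : (Set.range u).encard = Fintype.card α := by
    rw [← Set.image_univ, hu.injective.encard_image, Set.encard_univ, ENat.card_eq_coe_fintype_card]
  rw [← h1, ← hind.eRk_eq_encard]
  calc (matroid k K).eRk (Set.range u)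
      ≤ (matroid k K).eRk ((matroid k K).closure T) :=
        (matroid k K).eRk_mono (by rintro _ ⟨i, rfl⟩; exact hT i)
    _ = (matroid k K).eRk T := (matroid k K).eRk_closure_eq T
    _ ≤ T.encard := (matroid k K).eRk_le_encard T

theorem isAlgebraic_of_subring_le {k₁ k₂ : Type*} [CommRing k₁] [CommRing k₂] [Algebra k₁ K]
    [Algebra k₂ K] {A₁ : Subalgebra k₁ K} {A₂ : Subalgebra k₂ K}
    (h : A₁.toSubring ≤ A₂.toSubring) {a : K} (ha : IsAlgebraic A₁ a) : IsAlgebraic A₂ a :=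
  ha.ringHom_of_comp_eq (Subring.inclusion h : A₁.toSubring →+* A₂.toSubring) (RingHom.id K)
    (Subring.inclusion_injective h) rfl

/-- A dependent family over `k[C]` has a member in the algebraic closure of `C` and the others. -/
theorem exists_mem_closure_of_not_algebraicIndependent {τ : Type*} {C : Set K} {w : τ → K}
    (h : ¬ AlgebraicIndependent (adjoin k C) w) :
    ∃ i, w i ∈ (matroid k K).closure (C ∪ w '' {i}ᶜ) := by
  by_contra! hcon
  refine h (algebraicIndependent_of_finite_type' Subtype.val_injective fun t _ _ i hi halg ↦ ?_)
  refine hcon i ?_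
  have hsub : C ∪ w '' t ⊆ C ∪ w '' {i}ᶜ :=
    Set.union_subset_union_right _ (Set.image_mono fun j hj hji ↦ hi (hji ▸ hj))
  refine (matroid k K).closure_subset_closure hsub ?_
  rw [matroid_closure_eq, SetLike.mem_coe, Subalgebra.mem_algebraicClosure]
  have hle : (adjoin (adjoin k C) (w '' t)).toSubring ≤ (adjoin k (C ∪ w '' t)).toSubring := by
    intro x hx
    rw [Subalgebra.mem_toSubring] at hx ⊢
    rwa [adjoin_union_eq_adjoin_adjoin, Subalgebra.mem_restrictScalars]
  exact isAlgebraic_of_subring_le hle halg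

/-- A polynomial relation with coefficients in `k[c]`, not all zero, prevents algebraic
independence over `k[c]`. -/
theorem not_algebraicIndependent_of_eval₂_eq_zero {τ γ : Type*} {c : γ → K} {w : τ → K}
    {Q : MvPolynomial τ (MvPolynomial γ k)}
    (hQ : eval₂ (aeval c : _ →ₐ[k] K).toRingHom w Q = 0)
    {m : τ →₀ ℕ} (hm : aeval c (coeff m Q) ≠ 0) :
    ¬ AlgebraicIndependent (adjoin k (Set.range c)) w := by
  intro hw
  have hmem : ∀ r : MvPolynomial γ k, aeval c r ∈ adjoin k (Set.range c) := fun r ↦ by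
    rw [adjoin_range_eq_range_aeval]; exact ⟨r, rfl⟩
  let ψ : MvPolynomial γ k →ₐ[k] adjoin k (Set.range c) := (aeval c).codRestrict _ hmem
  have hzero : map ψ.toRingHom Q = 0 := by
    rw [algebraicIndependent_iff] at hw
    refine hw _ ?_
    rw [aeval_def, eval₂_map]
    exact hQ
  refine hm ?_
  have h3 := congrArg Subtype.val (congrArg (coeff m) hzero)
  rw [coeff_map, coeff_zero] at h3
  exact h3

/-- If each of the families `w j` satisfies a nonzero polynomial relation over `k[c]`, every `e i`
lies in `k[c]`, and all the `e i` and `w j i` together are algebraically independent,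
then the number of the `e i` and of relations is at most the number of the `c i`. -/
theorem card_add_card_le_of_relations {ε κ τ γ : Type*} [Fintype ε] [Fintype κ] [Fintype τ]
    [Fintype γ] {e : ε → K} {w : κ → τ → K} {c : γ → K}
    (hind : AlgebraicIndependent k (Sum.elim e fun p : κ × τ ↦ w p.1 p.2))
    (he : ∀ i, e i ∈ adjoin k (Set.range c))
    (hw : ∀ j, ¬ AlgebraicIndependent (adjoin k (Set.range c)) (w j)) :
    Fintype.card ε + Fintype.card κ ≤ Fintype.card γ := by
  classical
  -- From each block `w j` the redundant entry `i j` is dropped; `c` and the remaining entries still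
  -- generate everything up to algebraic closure.
  choose i hi using fun j ↦ exists_mem_closure_of_not_algebraicIndependent (hw j)
  let v : γ ⊕ (Σ j, {a // a ≠ i j}) → K := Sum.elim c fun p ↦ w p.1 p.2.1
  have hle := card_le_encard_of_isAlgebraic (T := Set.range v) hind ?_
  · have hv : (Set.range v).encard ≤ Fintype.card (γ ⊕ (Σ j, {a // a ≠ i j})) := by
      rw [← ENat.card_eq_coe_fintype_card, ← Set.encard_univ, ← Set.image_univ]
      exact Set.encard_image_le _ _
    have h := hle.trans hv
    rw [Nat.cast_le] at h
    simp only [Fintype.card_sum, Fintype.card_prod, Fintype.card_sigma] at h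
    have hs : ∀ j, Fintype.card {a // a ≠ i j} = Fintype.card τ - 1 := fun j ↦ by
      rw [Fintype.card_subtype_compl, Fintype.card_subtype_eq]
    have hsum : ∑ j, Fintype.card {a // a ≠ i j} + Fintype.card κ
        = Fintype.card κ * Fintype.card τ := by
      simp only [hs, Finset.sum_const, Finset.card_univ, smul_eq_mul]
      rcases isEmpty_or_nonempty κ with hκ | ⟨⟨j⟩⟩
      · simp
      · have : 0 < Fintype.card τ := Fintype.card_pos_iff.2 ⟨i j⟩
        obtain ⟨n, hn⟩ := Nat.exists_eq_add_of_lt this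
        rw [hn]; simp; ring
    omega
  · have hcv : Set.range c ⊆ Set.range v := by
      rintro _ ⟨g, rfl⟩; exact ⟨Sum.inl g, rfl⟩
    have hsub : ∀ T : Set K, T ⊆ (matroid k K).closure T := fun T ↦
      (matroid k K).subset_closure T (Set.subset_univ _)
    rintro (a | ⟨j, a⟩)
    · rw [matroid_closure_eq]
      exact isAlgebraic_algebraMap (⟨e a, adjoin_mono hcv (he a)⟩ : adjoin k (Set.range v))
    · by_cases ha : a = i j
      · subst ha
        refine (matroid k K).closure_subset_closure ?_ (hi j)
        refine Set.union_subset hcv ?_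
        rintro _ ⟨b, hb, rfl⟩
        exact ⟨Sum.inr ⟨j, b, hb⟩, rfl⟩
      · exact hsub _ ⟨Sum.inr ⟨j, a, ha⟩, rfl⟩

end Transcendence

/-! ### From real point sets to algebraic independence. -/

/-- Functions satisfying no polynomial relation become algebraically independent in a suitable
field to which the ring of all functions maps. -/
theorem exists_field_algebraicIndependent {X σ : Type} (f : σ → X → ℝ)
    (hf : ∀ p : MvPolynomial σ ℝ, p ≠ 0 → ∃ x, eval (fun i ↦ f i x) p ≠ 0) :
    ∃ (K : Type) (_ : Field K) (_ : Algebra ℝ K) (φ : (X → ℝ) →ₐ[ℝ] K),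
      AlgebraicIndependent ℝ fun i ↦ φ (f i) := by
  have hev : ∀ (p : MvPolynomial σ ℝ) x, aeval f p x = eval (fun i ↦ f i x) p := fun p x ↦ by
    have : (Pi.evalAlgHom ℝ (fun _ : X ↦ ℝ) x).comp (aeval f) = aeval fun i ↦ f i x := by
      ext i; simp
    simpa using DFunLike.congr_fun this p
  -- The values of nonzero polynomials at `f` form a multiplicative set without 0. Modulo a prime
  -- avoiding it, none of these values dies.
  let T : Submonoid (X → ℝ) := (nonZeroDivisors (MvPolynomial σ ℝ)).map (aeval f : _ →ₐ[ℝ] (X → ℝ))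
  have hT : Disjoint ((⊥ : Ideal (X → ℝ)) : Set (X → ℝ)) T := by
    rw [Set.disjoint_left]
    rintro g hg ⟨p, hp, rfl⟩
    obtain ⟨x, hx⟩ := hf p (nonZeroDivisors.ne_zero hp)
    refine hx ?_
    rw [← hev]
    exact congrFun (show aeval f p = 0 from hg) x
  obtain ⟨P, hP, -, hdis⟩ := Ideal.exists_le_prime_disjoint _ T hT
  refine ⟨FractionRing ((X → ℝ) ⧸ P), inferInstance, inferInstance,
    (IsScalarTower.toAlgHom ℝ ((X → ℝ) ⧸ P) (FractionRing ((X → ℝ) ⧸ P))).comp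
      (Ideal.Quotient.mkₐ ℝ P), ?_⟩
  rw [algebraicIndependent_iff]
  intro p hp
  by_contra hp0
  refine Set.disjoint_left.1 hdis (?_ : aeval f p ∈ P)
    ⟨p, mem_nonZeroDivisors_of_ne_zero hp0, rfl⟩
  rw [← Ideal.Quotient.eq_zero_iff_mem]
  apply IsFractionRing.injective ((X → ℝ) ⧸ P) (FractionRing ((X → ℝ) ⧸ P))
  rw [map_zero, ← hp]
  exact (DFunLike.congr_fun (comp_aeval (R := ℝ) f
    ((IsScalarTower.toAlgHom ℝ ((X → ℝ) ⧸ P) (FractionRing ((X → ℝ) ⧸ P))).comp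
      (Ideal.Quotient.mkₐ ℝ P))) p)

/-- Dimension count: let the points of a set be parametrized by `c : γ → ℝ`, in such a way
that the coordinates `e` are polynomials in `c` and each of the blocks `w j` lies on a hypersurface
with equation depending polynomially on `c`. If there are fewer parameters than
coordinates `e` and blocks, then a nonzero polynomial vanishes on the set. -/
theorem exists_ne_zero_eval_eq_zero {X ε κ τ γ : Type} [Fintype ε] [Fintype κ] [Fintype τ]
    [Fintype γ] (c : X → γ → ℝ) (w : X → κ → τ → ℝ) (e : ε → MvPolynomial γ ℝ)
    (Q : MvPolynomial τ (MvPolynomial γ ℝ))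
    (hQ0 : ∀ x, map (eval (c x)) Q ≠ 0)
    (hQ : ∀ x j, eval (w x j) (map (eval (c x)) Q) = 0)
    (hcard : Fintype.card γ < Fintype.card ε + Fintype.card κ) :
    ∃ p : MvPolynomial (ε ⊕ κ × τ) ℝ, p ≠ 0 ∧
      ∀ x, eval (Sum.elim (fun i ↦ eval (c x) (e i)) fun q ↦ w x q.1 q.2) p = 0 := by
  by_contra! hcon
  let f : ε ⊕ κ × τ → X → ℝ := fun s x ↦
    Sum.elim (fun i ↦ eval (c x) (e i)) (fun q ↦ w x q.1 q.2) s
  obtain ⟨K, _, _, φ, hφ⟩ := exists_field_algebraicIndependent f hcon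
  let c' : γ → X → ℝ := fun g x ↦ c x g
  have hc' : ∀ (r : MvPolynomial γ ℝ) x, aeval c' r x = eval (c x) r := fun r x ↦ by
    have : (Pi.evalAlgHom ℝ (fun _ : X ↦ ℝ) x).comp (aeval c') = aeval (c x) := by
      ext i; simp [c']
    simpa using DFunLike.congr_fun this r
  have hφc : ∀ r : MvPolynomial γ ℝ, φ (aeval c' r) = aeval (fun g ↦ φ (c' g)) r := fun r ↦
    DFunLike.congr_fun (comp_aeval (R := ℝ) c' φ) r
  have hmem : ∀ r : MvPolynomial γ ℝ,
      φ (aeval c' r) ∈ adjoin ℝ (Set.range fun g ↦ φ (c' g)) := fun r ↦ by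
    rw [adjoin_range_eq_range_aeval, hφc]; exact ⟨r, rfl⟩
  have hind : AlgebraicIndependent ℝ
      (Sum.elim (fun i ↦ φ (f (Sum.inl i))) fun p : κ × τ ↦ φ (f (Sum.inr (p.1, p.2)))) := by
    convert hφ using 1
    ext (i | i) <;> rfl
  refine absurd (card_add_card_le_of_relations (c := fun g ↦ φ (c' g))
    (w := fun j a ↦ φ (f (Sum.inr (j, a)))) hind (fun i ↦ ?_) fun j hj ↦ ?_) (not_le.2 hcard)
  · convert hmem (e i)
    ext x; rw [hc']; rfl
  -- This sum of squares vanishes nowhere, so it is a unit in the ring of all functions and survives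
  -- in `K`. Hence some coefficient of `Q` survives too, and the relation stays nontrivial.
  · let g : X → ℝ := ∑ m ∈ Q.support, aeval c' (coeff m Q) ^ 2
    have hg : ∀ x, g x ≠ 0 := by
      intro x hx
      refine hQ0 x ?_
      have hx' : ∑ m ∈ Q.support, eval (c x) (coeff m Q) ^ 2 = 0 := by
        rw [← hx]; simp [g, hc']
      rw [Finset.sum_eq_zero_iff_of_nonneg fun _ _ ↦ sq_nonneg _] at hx'
      ext m
      rw [coeff_map, coeff_zero]
      by_cases hm : m ∈ Q.support
      · exact pow_eq_zero_iff two_ne_zero |>.1 (hx' m hm)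
      · rw [notMem_support_iff.1 hm, map_zero]
    have hφg : φ g ≠ 0 := by
      intro h0
      have h4 : φ (g * fun x ↦ (g x)⁻¹) = 1 := by
        rw [← map_one φ]
        congr 1
        ext x; exact mul_inv_cancel₀ (hg x)
      rw [map_mul, h0, zero_mul] at h4
      exact zero_ne_one h4
    obtain ⟨m, hm⟩ : ∃ m, aeval (fun g ↦ φ (c' g)) (coeff m Q) ≠ 0 := by
      by_contra! hall
      refine hφg ?_
      rw [map_sum]
      refine Finset.sum_eq_zero fun m _ ↦ ?_
      rw [map_pow, hφc, hall, zero_pow two_ne_zero]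
    refine not_algebraicIndependent_of_eval₂_eq_zero (Q := Q) ?_ hm hj
    have h1 : eval₂ (aeval c' : _ →ₐ[ℝ] (X → ℝ)).toRingHom (fun a ↦ f (Sum.inr (j, a))) Q = 0 := by
      ext x
      refine (hom_eval₂ _ _ (Pi.evalRingHom (fun _ : X ↦ ℝ) x) _).trans ?_
      rw [Pi.zero_apply, ← hQ x j, eval_map]
      congr 1
      exact RingHom.ext fun r ↦ hc' r x
    have h2 := congrArg φ.toRingHom h1
    rw [map_zero, hom_eval₂] at h2
    rw [← h2]
    congr 1
    exact RingHom.ext fun r ↦ (hφc r).symm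

end PowerSpectrum

/-! ### Thin sets. -/

namespace PowerSpectrum

open MvPolynomial

/-- A set of tuples of complex numbers is thin if some nonzero real polynomial in the real and
imaginary parts vanishes on it. -/
def IsThin {ι : Type*} (A : Set (ι → ℂ)) : Prop :=
  ∃ p : MvPolynomial (ι ⊕ ι) ℝ, p ≠ 0 ∧ ∀ z ∈ A, eval (realCoords z) p = 0

section Thin

variable {ι ι' : Type*}

theorem realCoords_surjective : Function.Surjective (realCoords : (ι → ℂ) → ι ⊕ ι → ℝ) := fun r ↦
  ⟨fun i ↦ ⟨r (Sum.inl i), r (Sum.inr i)⟩, by ext (i | i) <;> rfl⟩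

theorem exists_eval_realCoords_ne_zero {p : MvPolynomial (ι ⊕ ι) ℝ} (hp : p ≠ 0) :
    ∃ z : ι → ℂ, eval (realCoords z) p ≠ 0 := by
  by_contra! h
  refine hp (MvPolynomial.funext fun r ↦ ?_)
  obtain ⟨z, rfl⟩ := realCoords_surjective r
  rw [h, map_zero]

theorem isThin_iUnion {α : Type*} [Finite α] {A : α → Set (ι → ℂ)} (h : ∀ a, IsThin (A a)) :
    IsThin (⋃ a, A a) := by
  have := Fintype.ofFinite α
  choose p hp hz using h
  refine ⟨∏ a, p a, Finset.prod_ne_zero_iff.2 fun a _ ↦ hp a, fun z hzA ↦ ?_⟩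
  obtain ⟨a, ha⟩ := Set.mem_iUnion.1 hzA
  rw [map_prod]
  exact Finset.prod_eq_zero (Finset.mem_univ a) (hz a z ha)

theorem IsThin.union {A B : Set (ι → ℂ)} (hA : IsThin A) (hB : IsThin B) : IsThin (A ∪ B) := by
  rw [Set.union_eq_iUnion]
  exact isThin_iUnion fun b ↦ by cases b <;> assumption

/-- Real polynomials pull back along complex linear maps. -/
theorem exists_eval_realCoords_comp [Fintype ι] (L : (ι → ℂ) →ₗ[ℂ] (ι' → ℂ))
    (p : MvPolynomial (ι' ⊕ ι') ℝ) :
    ∃ q : MvPolynomial (ι ⊕ ι) ℝ, ∀ z, eval (realCoords z) q = eval (realCoords (L z)) p := by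
  classical
  let m : ι' → ι → ℂ := fun i j ↦ L (Pi.single j 1) i
  have hL : ∀ z i, L z i = ∑ j, m i j * z j := fun z i ↦ by
    conv_lhs => rw [pi_eq_sum_univ' z]
    simp [m, mul_comm]
  let P : ι' ⊕ ι' → MvPolynomial (ι ⊕ ι) ℝ := Sum.elim
    (fun i ↦ ∑ j, (C (m i j).re * X (Sum.inl j) - C (m i j).im * X (Sum.inr j)))
    (fun i ↦ ∑ j, (C (m i j).re * X (Sum.inr j) + C (m i j).im * X (Sum.inl j)))
  refine ⟨bind₁ P p, fun z ↦ ?_⟩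
  have hP : (fun s ↦ eval (realCoords z) (P s)) = realCoords (L z) := by
    ext (i | i) <;> simp [P, realCoords, hL]
  rw [← hP]
  simp only [eval, eval₂Hom_bind₁]

theorem IsThin.preimage [Fintype ι] {A : Set (ι' → ℂ)} (hA : IsThin A)
    (L : (ι → ℂ) →ₗ[ℂ] (ι' → ℂ)) (hL : Function.Surjective L) : IsThin (L ⁻¹' A) := by
  obtain ⟨p, hp, hz⟩ := hA
  obtain ⟨q, hq⟩ := exists_eval_realCoords_comp L p
  refine ⟨q, ?_, fun z hzA ↦ by rw [hq]; exact hz _ hzA⟩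
  rintro rfl
  obtain ⟨y, hy⟩ := exists_eval_realCoords_ne_zero hp
  obtain ⟨x, rfl⟩ := hL y
  exact hy (by rw [← hq, map_zero])

theorem eval_map_sumAlgEquiv {α β : Type*} (p : MvPolynomial (α ⊕ β) ℝ) (a : α → ℝ) (b : β → ℝ) :
    eval a (map (eval b) (sumAlgEquiv ℝ α β p)) = eval (Sum.elim a b) p := by
  induction p using MvPolynomial.induction_on with
  | C r => simp
  | add p q hp hq => simp only [map_add, hp, hq]
  | mul_X p i hp =>
    rw [map_mul, map_mul, map_mul, hp, map_mul]
    congr 1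
    rcases i with i | i <;> simp

/-- All but a thin set of the sections of a thin set are thin. -/
theorem IsThin.sections {A : Set (ι ⊕ ι' → ℂ)} (hA : IsThin A) :
    IsThin {y : ι' → ℂ | ¬ IsThin {x : ι → ℂ | Sum.elim x y ∈ A}} := by
  obtain ⟨p, hp, hz⟩ := hA
  let f : (ι ⊕ ι') ⊕ (ι ⊕ ι') → (ι ⊕ ι) ⊕ (ι' ⊕ ι') := Equiv.sumSumSumComm ι ι' ι ι'
  have hf : Function.Injective f := Equiv.injective _
  have hp' : sumAlgEquiv ℝ (ι ⊕ ι) (ι' ⊕ ι') (rename f p) ≠ 0 := by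
    simpa using (rename_injective f hf).ne hp
  -- View `p` as a polynomial in `x` with coefficients polynomial in `y`: wherever one fixed nonzero
  -- coefficient does not vanish, `p` restricts to a nonzero polynomial on the section.
  obtain ⟨m, hm⟩ := MvPolynomial.ne_zero_iff.1 hp'
  refine ⟨_, hm, fun y hy ↦ ?_⟩
  by_contra hne
  refine hy ⟨map (eval (realCoords y)) (sumAlgEquiv ℝ _ _ (rename f p)), ?_, fun x hx ↦ ?_⟩
  · intro h0
    apply hne
    rw [← coeff_map, h0, coeff_zero]
  · rw [eval_map_sumAlgEquiv, eval_rename, ← hz _ hx]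
    congr 2
    ext ((i | i) | (i | i)) <;> rfl

end Thin

/-! ### Genericity on the space of bases. -/

section Generic

theorem isRealAlgebraic_zeros {σ : Type*} (p : MvPolynomial σ ℝ) :
    IsRealAlgebraic {x : σ → ℝ | eval x p = 0} :=
  ⟨Ideal.span {p}, by ext x; simp [zeroLocus_span, aeval_eq_eval]⟩

/-- Over `ℂ`, the product of `p` and the determinant is a nonzero polynomial in the real
coordinates, so it cannot vanish at all real points. -/
theorem exists_basis_eval_ne_zero {N : ℕ} {p : MvPolynomial ((Fin N × Fin N) ⊕ (Fin N × Fin N)) ℝ}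
    (hp : p ≠ 0) : ∃ V : OrderedBasis N, eval (basisCoords V) p ≠ 0 := by
  let σ := (Fin N × Fin N) ⊕ (Fin N × Fin N)
  let D : Matrix (Fin N) (Fin N) (MvPolynomial σ ℂ) := Matrix.of fun i k ↦
    X (Sum.inl (i, k)) + C Complex.I * X (Sum.inr (i, k))
  have hD : ∀ r : σ → ℂ, eval r D.det =
      (Matrix.of fun i k ↦ r (Sum.inl (i, k)) + Complex.I * r (Sum.inr (i, k))).det := fun r ↦ by
    rw [RingHom.map_det]
    congr 1
    ext i k; simp [D]
  have hD0 : D.det ≠ 0 := by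
    intro h0
    have h1 := hD (Sum.elim (fun q ↦ (1 : Matrix (Fin N) (Fin N) ℂ) q.1 q.2) 0)
    rw [h0, map_zero] at h1
    have h2 : (Matrix.of fun i k ↦ (1 : Matrix (Fin N) (Fin N) ℂ) i k) = 1 := rfl
    simp [h2] at h1
  have hp' : map Complex.ofRealHom p * D.det ≠ 0 :=
    mul_ne_zero (by simpa using (map_injective _ Complex.ofReal_injective).ne hp) hD0
  obtain ⟨r, hr, hne⟩ : ∃ r ∈ Set.pi Set.univ fun _ : σ ↦ Set.range Complex.ofReal,
      eval r (map Complex.ofRealHom p * D.det) ≠ 0 := by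
    by_contra! hcon
    refine hp' (funext_set (fun _ : σ ↦ Set.range Complex.ofReal)
      (fun _ ↦ Set.infinite_range_of_injective Complex.ofReal_injective) fun r hr ↦ ?_)
    rw [hcon r hr, map_zero]
  choose x hx using fun s ↦ hr s trivial
  obtain rfl : (fun s ↦ (x s : ℂ)) = r := funext hx
  rw [map_mul, hD] at hne
  obtain ⟨z, rfl⟩ := realCoords_surjective x
  have hA : IsUnit (Matrix.of fun i k ↦ z (i, k)).det := by
    rw [isUnit_iff_ne_zero]
    convert right_ne_zero_of_mul hne using 3
    ext i k
    rw [mul_comm]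
    exact (Complex.re_add_im _).symm
  have hli := Matrix.linearIndependent_rows_of_isUnit ((Matrix.isUnit_iff_isUnit_det _).2 hA)
  have hcard : Fintype.card (Fin N) = Module.finrank ℂ (Fin N → ℂ) := by simp
  let V : OrderedBasis N := Module.Basis.mk hli
    (hli.span_eq_top_of_card_eq_finrank' hcard).ge
  refine ⟨V, fun h0 ↦ left_ne_zero_of_mul hne ?_⟩
  have hV : basisCoords V = realCoords z := by
    simp only [basisCoords, V, Module.Basis.coe_mk]
    rfl
  rw [hV] at h0
  have h1 := eval₂_comp_left Complex.ofRealHom (RingHom.id ℝ) (realCoords z) p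
  rw [eval₂_id, h0, map_zero] at h1
  rw [eval_map]
  exact h1.symm

theorem holdsGenerically_of_isThin {N : ℕ} {Q : OrderedBasis N → Prop}
    {A : Set (Fin N × Fin N → ℂ)} (hA : IsThin A)
    (h : ∀ V : OrderedBasis N, (fun q : Fin N × Fin N ↦ V q.1 q.2) ∉ A → Q V) :
    HoldsGenerically basisCoords Q := by
  obtain ⟨p, hp, hz⟩ := hA
  exact ⟨_, isRealAlgebraic_zeros p, exists_basis_eval_ne_zero hp,
    fun V hV ↦ h V fun hVA ↦ hV (hz _ hVA)⟩

end Generic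

/-! ### Global phases. -/

section Phase

variable {ι : Type*} [Fintype ι]

/-- Two linear functionals of equal absolute value differ by a phase. -/
theorem exists_phase_of_norm_sum_eq (a b : ι → ℂ)
    (h : ∀ w : ι → ℂ, ‖∑ i, a i * w i‖ = ‖∑ i, b i * w i‖) :
    ∃ t : ℂ, ‖t‖ = 1 ∧ a = t • b := by
  classical
  by_cases ha : a = 0
  · refine ⟨1, norm_one, ?_⟩
    ext i
    have := h (Pi.single i 1)
    simp [ha, Pi.single_apply] at this
    simp [ha, norm_eq_zero.1 this.symm]
  obtain ⟨l, hl⟩ := Function.ne_iff.1 ha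
  rw [Pi.zero_apply] at hl
  have hnorm : ‖a l‖ = ‖b l‖ := by simpa [Pi.single_apply] using h (Pi.single l 1)
  have hbl : b l ≠ 0 := by rw [← norm_ne_zero_iff, ← hnorm]; exact norm_ne_zero_iff.2 hl
  refine ⟨a l / b l, by rw [norm_div, hnorm, div_self (norm_ne_zero_iff.2 hbl)], ?_⟩
  ext i
  -- This vector is killed by `a`, hence by `b`, which makes `b` proportional to `a`.
  have := h (Pi.single i 1 - Pi.single l (a i / a l))
  simp only [Pi.sub_apply, Pi.single_apply, mul_sub, Finset.sum_sub_distrib, mul_ite, mul_one,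
    mul_zero, Finset.sum_ite_eq', Finset.mem_univ, if_true] at this
  rw [mul_div_cancel₀ _ hl, sub_self, norm_zero, eq_comm, norm_eq_zero, sub_eq_zero] at this
  rw [Pi.smul_apply, smul_eq_mul, this]
  field_simp

/-- Every complex number becomes real after multiplication with a phase. -/
theorem exists_phase_mul_im_eq_zero (z : ℂ) : ∃ t : ℂ, ‖t‖ = 1 ∧ (t * z).im = 0 := by
  by_cases hz : z = 0
  · exact ⟨1, norm_one, by simp [hz]⟩
  · refine ⟨‖z‖ / z, ?_, ?_⟩
    · rw [norm_div, Complex.norm_real, norm_norm, div_self (norm_ne_zero_iff.2 hz)]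
    · rw [div_mul_cancel₀ _ hz, Complex.ofReal_im]

end Phase

/-! ### The quadric attached to a linear form. -/

section Quadric

variable {ι R : Type*} [Fintype ι] [CommRing R]

/-- The squared absolute value of the linear form with coefficients `aR + i aI`, as a polynomial in
the real and imaginary parts of its argument. -/
noncomputable def normSqForm (aR aI : ι → R) : MvPolynomial (ι ⊕ ι) R :=
  (∑ i, (C (aR i) * X (Sum.inl i) - C (aI i) * X (Sum.inr i))) ^ 2 +
    (∑ i, (C (aR i) * X (Sum.inr i) + C (aI i) * X (Sum.inl i))) ^ 2

theorem eval_normSqForm (f : R →+* ℝ) (aR aI : ι → R) (a w : ι → ℂ)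
    (hR : ∀ i, f (aR i) = (a i).re) (hI : ∀ i, f (aI i) = (a i).im) :
    eval (realCoords w) (map f (normSqForm aR aI)) = ‖∑ i, a i * w i‖ ^ 2 := by
  rw [← Complex.normSq_eq_norm_sq, Complex.normSq_apply, ← sq, ← sq, Complex.re_sum, Complex.im_sum]
  simp [normSqForm, hR, hI, realCoords]

end Quadric

/-! ### Dimension counts for bad matrices and for spectra. -/

section Params

variable {ι : Type} [DecidableEq ι] {γ : Type}

/-- The polynomials which are coordinates on `S` and constants outside `S`. -/
noncomputable def partialCoords (S : Finset ι) (s : S → γ) (r : ι → ℝ) (i : ι) : MvPolynomial γ ℝ :=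
  if h : i ∈ S then X (s ⟨i, h⟩) else C (r i)

theorem eval_partialCoords (S : Finset ι) (s : S → γ) (r : ι → ℝ) (c : γ → ℝ) (v : ι → ℝ)
    (hc : ∀ i : S, c (s i) = v i) (hv : ∀ i ∉ S, v i = r i) (i : ι) :
    eval c (partialCoords S s r i) = v i := by
  by_cases h : i ∈ S
  · simp [partialCoords, h, hc]
  · simp [partialCoords, h, hv]

/-- If the vectors `a` and `b` have few free real coordinates, then for all but a thin set of
matrices `z` the linear forms `a` and `b` have equal absolute values on the rows of `z` only if
they agree up to a phase. Some coordinates of `a` may be added to the data. -/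
theorem isThin_unresolved_pairs {κ ε : Type} [Fintype ι] [Fintype κ] [Fintype ε]
    (A₁ A₂ B₁ B₂ : Finset ι) (a₀ : ι → ℂ) (s : ε → ι)
    (hcard : A₁.card + A₂.card + B₁.card + B₂.card < 2 * Fintype.card ε + Fintype.card κ) :
    IsThin {z : ε ⊕ κ × ι → ℂ | ∃ a b : ι → ℂ,
      (∀ i ∉ A₁, (a i).re = (a₀ i).re) ∧ (∀ i ∉ A₂, (a i).im = (a₀ i).im) ∧
      (∀ i ∉ B₁, (b i).re = 0) ∧ (∀ i ∉ B₂, (b i).im = 0) ∧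
      (∀ j, z (Sum.inl j) = a (s j)) ∧
      (∀ k, ‖∑ i, a i * z (Sum.inr (k, i))‖ = ‖∑ i, b i * z (Sum.inr (k, i))‖) ∧
      ¬ ∃ t : ℂ, ‖t‖ = 1 ∧ a = t • b} := by
  set A := {z : ε ⊕ κ × ι → ℂ | _} with hA
  choose a b hA₁ hA₂ hB₁ hB₂ hs hk hne using fun x : A ↦ x.2
  let γ := (A₁ ⊕ A₂) ⊕ (B₁ ⊕ B₂)
  let c : A → γ → ℝ := fun x ↦ Sum.elim
    (Sum.elim (fun i ↦ (a x i).re) fun i ↦ (a x i).im)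
    (Sum.elim (fun i ↦ (b x i).re) fun i ↦ (b x i).im)
  let aR : ι → MvPolynomial γ ℝ := partialCoords A₁ (fun i ↦ .inl (.inl i)) fun i ↦ (a₀ i).re
  let aI : ι → MvPolynomial γ ℝ := partialCoords A₂ (fun i ↦ .inl (.inr i)) fun i ↦ (a₀ i).im
  let bR : ι → MvPolynomial γ ℝ := partialCoords B₁ (fun i ↦ .inr (.inl i)) fun _ ↦ 0
  let bI : ι → MvPolynomial γ ℝ := partialCoords B₂ (fun i ↦ .inr (.inr i)) fun _ ↦ 0
  have haR : ∀ x i, eval (c x) (aR i) = (a x i).re := fun x i ↦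
    eval_partialCoords _ _ _ (c x) (fun i ↦ (a x i).re) (by intro; rfl) (hA₁ x) i
  have haI : ∀ x i, eval (c x) (aI i) = (a x i).im := fun x i ↦
    eval_partialCoords _ _ _ (c x) (fun i ↦ (a x i).im) (by intro; rfl) (hA₂ x) i
  have hbR : ∀ x i, eval (c x) (bR i) = (b x i).re := fun x i ↦
    eval_partialCoords _ _ _ (c x) (fun i ↦ (b x i).re) (by intro; rfl) (hB₁ x) i
  have hbI : ∀ x i, eval (c x) (bI i) = (b x i).im := fun x i ↦
    eval_partialCoords _ _ _ (c x) (fun i ↦ (b x i).im) (by intro; rfl) (hB₂ x) i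
  have hQ : ∀ (x : A) (w : ι → ℂ),
      eval (realCoords w) (map (eval (c x)) (normSqForm aR aI - normSqForm bR bI)) =
        ‖∑ i, a x i * w i‖ ^ 2 - ‖∑ i, b x i * w i‖ ^ 2 := fun x w ↦ by
    rw [map_sub, map_sub, eval_normSqForm _ aR aI (a x) w (haR x) (haI x),
      eval_normSqForm _ bR bI (b x) w (hbR x) (hbI x)]
  have hQ0 : ∀ x, map (eval (c x)) (normSqForm aR aI - normSqForm bR bI) ≠ 0 := fun x h0 ↦
    hne x <| exists_phase_of_norm_sum_eq _ _ fun w ↦ by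
      have h1 := hQ x w
      rw [h0, map_zero, eq_comm, sub_eq_zero] at h1
      exact (sq_eq_sq₀ (norm_nonneg _) (norm_nonneg _)).1 h1
  obtain ⟨p, hp, hpz⟩ := exists_ne_zero_eval_eq_zero c
    (fun x (k : κ) ↦ realCoords fun i ↦ x.1 (Sum.inr (k, i)))
    (Sum.elim (fun j ↦ aR (s j)) fun j ↦ aI (s j)) (normSqForm aR aI - normSqForm bR bI)
    hQ0 (fun x k ↦ by rw [hQ, hk x k, sub_self])
    (by simp only [γ, Fintype.card_sum, Fintype.card_coe]; omega)
  let f : (ε ⊕ ε) ⊕ κ × (ι ⊕ ι) ≃ (ε ⊕ κ × ι) ⊕ (ε ⊕ κ × ι) :=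
    (Equiv.sumCongr (Equiv.refl _) (Equiv.prodSumDistrib κ ι ι)).trans
      (Equiv.sumSumSumComm ε ε (κ × ι) (κ × ι))
  refine ⟨rename f p, (map_ne_zero_iff _ (rename_injective f f.injective)).2 hp, fun z hz ↦ ?_⟩
  rw [eval_rename, ← hpz ⟨z, hz⟩]
  congr 2
  ext ((j | j) | ⟨k, (i | i)⟩)
  · exact (congrArg Complex.re (hs ⟨z, hz⟩ j)).trans (haR ⟨z, hz⟩ (s j)).symm
  · exact (congrArg Complex.im (hs ⟨z, hz⟩ j)).trans (haI ⟨z, hz⟩ (s j)).symm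
  · rfl
  · rfl

/-- A nonzero polynomial relation satisfied by the squared absolute values of the entries of `W b`
together with the entries of `W`. -/
theorem exists_relation_norm_sq {κ : Type} [Fintype ι] [Fintype κ] (j₀ : ι)
    (hcard : 2 * Fintype.card ι - 1 < Fintype.card κ) :
    ∃ H : MvPolynomial (κ ⊕ (κ × ι ⊕ κ × ι)) ℝ, H ≠ 0 ∧ ∀ (W : κ × ι → ℂ) (b : ι → ℂ),
      eval (Sum.elim (fun k ↦ ‖∑ i, b i * W (k, i)‖ ^ 2) (realCoords W)) H = 0 := by
  let B : Set ((κ × ι → ℂ) × (ι → ℂ)) := {x | (x.2 j₀).im = 0}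
  -- Rotating `b` makes its entry at `j₀` real, which leaves `2 * card ι - 1` real parameters.
  let S : Finset ι := Finset.univ.erase j₀
  let γ := ι ⊕ S
  let c : B → γ → ℝ := fun x ↦ Sum.elim (fun i ↦ (x.1.2 i).re) fun i ↦ (x.1.2 i).im
  let bR : ι → MvPolynomial γ ℝ := fun i ↦ X (.inl i)
  let bI : ι → MvPolynomial γ ℝ := partialCoords S .inr fun _ ↦ 0
  have hbR : ∀ x i, eval (c x) (bR i) = (x.1.2 i).re := fun x i ↦ by simp [bR, c]
  have hbI : ∀ x i, eval (c x) (bI i) = (x.1.2 i).im := fun x i ↦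
    eval_partialCoords _ _ _ (c x) (fun i ↦ (x.1.2 i).im) (by intro; rfl) (fun i hi ↦ by
      obtain rfl : i = j₀ := by simpa [S] using hi
      exact x.2) i
  -- Each block is a row of `W` extended by one variable for its spectral value.
  let Q : MvPolynomial (Unit ⊕ (ι ⊕ ι)) (MvPolynomial γ ℝ) :=
    X (.inl ()) - rename .inr (normSqForm bR bI)
  have hQ : ∀ (x : B) (w : ι → ℂ) (r : ℝ),
      eval (Sum.elim (fun _ ↦ r) (realCoords w)) (map (eval (c x)) Q) =
        r - ‖∑ i, x.1.2 i * w i‖ ^ 2 := fun x w r ↦ by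
    rw [← eval_normSqForm (eval (c x)) bR bI _ w (hbR x) (hbI x)]
    simp only [Q, map_sub, map_X, eval_X, map_rename, eval_rename]
    rfl
  have hQ0 : ∀ x, map (eval (c x)) Q ≠ 0 := fun x h0 ↦ by
    have h1 := hQ x 0 1
    rw [h0] at h1
    simp at h1
  have hγ : Fintype.card γ < Fintype.card Empty + Fintype.card κ := by
    have : 0 < Fintype.card ι := Fintype.card_pos_iff.2 ⟨j₀⟩
    simp only [γ, S, Fintype.card_sum, Fintype.card_coe, Fintype.card_empty,
      Finset.card_erase_of_mem (Finset.mem_univ j₀), Finset.card_univ]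
    omega
  obtain ⟨p, hp, hpz⟩ := exists_ne_zero_eval_eq_zero (ε := Empty) c
    (fun x (k : κ) ↦ Sum.elim (fun _ ↦ ‖∑ i, x.1.2 i * x.1.1 (k, i)‖ ^ 2)
      (realCoords fun i ↦ x.1.1 (k, i))) Empty.elim Q
    hQ0 (fun x k ↦ by rw [hQ, sub_self]) hγ
  let f : Empty ⊕ κ × (Unit ⊕ (ι ⊕ ι)) ≃ κ ⊕ (κ × ι ⊕ κ × ι) :=
    (Equiv.emptySum Empty _).trans <| (Equiv.prodSumDistrib κ Unit (ι ⊕ ι)).trans <|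
      Equiv.sumCongr (Equiv.prodPUnit κ) (Equiv.prodSumDistrib κ ι ι)
  refine ⟨rename f p, (map_ne_zero_iff _ (rename_injective f f.injective)).2 hp, fun W b ↦ ?_⟩
  obtain ⟨t, ht, htb⟩ := exists_phase_mul_im_eq_zero (b j₀)
  rw [eval_rename, ← hpz ⟨(W, t • b), htb⟩]
  congr 2
  ext (⟨⟨⟩⟩ | ⟨k, (_ | (i | i))⟩)
  · change ‖∑ i, b i * W (k, i)‖ ^ 2 = ‖∑ i, t * b i * W (k, i)‖ ^ 2
    simp [mul_assoc, ← Finset.mul_sum, ht]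
  · rfl
  · rfl

/-- Outside a thin set of matrices `W`, some polynomial vanishes at the squared absolute values of
all `W b` with `b` supported on `S`, but not at those of the column `j` outside `S`. -/
theorem isThin_spectrum_not_separated {κ : Type} [Fintype ι] [Fintype κ] {S : Finset ι} {j j₀ : ι}
    (hj : j ∉ S) (hj₀ : j₀ ∈ S) (hcard : 2 * S.card - 1 < Fintype.card κ) :
    IsThin {W : κ × ι → ℂ | ¬ ∃ h : MvPolynomial κ ℝ,
      (∀ b : ι → ℂ, (∀ i ∉ S, b i = 0) → eval (fun k ↦ ‖∑ i, b i * W (k, i)‖ ^ 2) h = 0) ∧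
      eval (fun k ↦ ‖W (k, j)‖ ^ 2) h ≠ 0} := by
  obtain ⟨H, hH, hHz⟩ := exists_relation_norm_sq (ι := S) (κ := κ) ⟨j₀, hj₀⟩ (by simpa using hcard)
  let G : κ ⊕ (κ × S ⊕ κ × S) → MvPolynomial (κ × ι ⊕ κ × ι) ℝ := Sum.elim
    (fun k ↦ X (.inl (k, j)) ^ 2 + X (.inr (k, j)) ^ 2)
    (Sum.elim (fun q ↦ X (.inl (q.1, q.2))) fun q ↦ X (.inr (q.1, q.2)))
  have hG : ∀ W : κ × ι → ℂ, eval (realCoords W) (bind₁ G H) =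
      eval (Sum.elim (fun k ↦ ‖W (k, j)‖ ^ 2) (realCoords fun q : κ × S ↦ W (q.1, q.2))) H := by
    intro W
    simp only [eval, eval₂Hom_bind₁]
    congr 2
    ext (k | (q | q))
    · rw [Sum.elim_inl, ← Complex.normSq_eq_norm_sq, Complex.normSq_apply]
      simp [G, realCoords, sq]
    · simp [G, realCoords]
    · simp [G, realCoords]
  refine ⟨bind₁ G H, fun h0 ↦ ?_, fun W hW ↦ ?_⟩
  · refine hH (funext_set (Sum.elim (fun _ ↦ Set.Ioi 0) fun _ ↦ Set.univ) ?_ fun r hr ↦ ?_)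
    · rintro (k | q)
      · exact Set.Ioi_infinite 0
      · exact Set.infinite_univ
    have hr0 : ∀ k, 0 < r (.inl k) := fun k ↦ hr (.inl k) trivial
    -- Since `j ∉ S`, column `j` can be chosen independently of the columns in `S`; square roots
    -- realise any positive spectrum there.
    let W : κ × ι → ℂ := fun q ↦ if h : q.2 ∈ S then
      ⟨r (.inr (.inl (q.1, ⟨q.2, h⟩))), r (.inr (.inr (q.1, ⟨q.2, h⟩)))⟩ else √(r (.inl q.1))
    have h1 := hG W
    rw [h0, map_zero, eq_comm] at h1
    rw [map_zero, ← h1]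
    congr 2
    ext (k | (q | q))
    · simp [W, hj, Real.sq_sqrt (hr0 k).le]
    · simp [W, realCoords]
    · simp [W, realCoords]
  · by_contra hne
    rw [hG] at hne
    let v := realCoords fun q : κ × S ↦ W (q.1, q.2)
    have hv : ∀ u : κ → ℝ, eval u (bind₁ (Sum.elim X fun q ↦ C (v q)) H) =
        eval (Sum.elim u v) H := fun u ↦ by
      simp only [eval, eval₂Hom_bind₁]
      congr 2
      ext (k | q) <;> simp
    refine hW ⟨bind₁ (Sum.elim X fun q ↦ C (v q)) H, fun b hb ↦ ?_, by rwa [hv]⟩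
    rw [hv, ← hHz (fun q : κ × S ↦ W (q.1, q.2)) fun i ↦ b i]
    congr 3
    ext k
    congr 2
    rw [Finset.sum_coe_sort S fun i ↦ b i * W (k, i)]
    exact (Finset.sum_subset (Finset.subset_univ S) fun i _ hi ↦ by simp [hb i hi]).symm

end Params

/-! ### Reduction from bases to matrices via the Fourier transform. -/

section Fourier

variable {N : ℕ}

theorem isUnit_dftMatrix (N : ℕ) : IsUnit (dftMatrix N) := by
  rw [Matrix.isUnit_iff_isUnit_det, isUnit_iff_ne_zero]
  rcases Nat.eq_zero_or_pos N with rfl | hN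
  · simp
  set ω := Complex.exp (-2 * Real.pi * Complex.I / N) with hω
  have hprim : IsPrimitiveRoot ω N := by
    have h := (Complex.isPrimitiveRoot_exp N hN.ne').inv
    rwa [← Complex.exp_neg, show -(2 * (Real.pi : ℂ) * Complex.I / N)
      = -2 * Real.pi * Complex.I / N by ring] at h
  have hF : dftMatrix N = Matrix.vandermonde fun j : Fin N ↦ ω ^ (j : ℕ) := by
    ext j k
    simp [dftMatrix, Matrix.vandermonde_apply, hω, pow_mul]
  rw [hF, Matrix.det_vandermonde_ne_zero_iff]
  exact fun i j hij ↦ Fin.ext (hprim.pow_inj i.2 j.2 hij)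

theorem eq_zero_of_powerSpectrum_eq_zero {x : Fin N → ℂ} (hx : powerSpectrum x = 0) : x = 0 := by
  refine Matrix.mulVec_injective_of_isUnit (isUnit_dftMatrix N) ?_
  rw [Matrix.mulVec_zero]
  ext k
  simpa [powerSpectrum] using congrFun hx k

theorem powerSpectrum_smul {t : ℂ} (ht : ‖t‖ = 1) (x : Fin N → ℂ) :
    powerSpectrum (t • x) = powerSpectrum x := by
  ext k
  simp [powerSpectrum, Matrix.mulVec_smul, ht]

theorem EqUpToPhase.powerSpectrum_eq {x y : Fin N → ℂ} (h : EqUpToPhase x y) :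
    powerSpectrum x = powerSpectrum y := by
  obtain ⟨t, ht, rfl⟩ := h
  exact powerSpectrum_smul ht y

/-- The map sending a tuple of vectors to the matrix whose columns are their Fourier transforms. -/
noncomputable def dftColumns (N : ℕ) : (Fin N × Fin N → ℂ) →ₗ[ℂ] (Fin N × Fin N → ℂ) where
  toFun v q := (dftMatrix N *ᵥ fun m ↦ v (q.2, m)) q.1
  map_add' u v := by
    ext q
    exact congrFun (Matrix.mulVec_add (dftMatrix N) (fun m ↦ u (q.2, m)) fun m ↦ v (q.2, m)) q.1
  map_smul' t v := by
    ext q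
    exact congrFun (Matrix.mulVec_smul (dftMatrix N) t fun m ↦ v (q.2, m)) q.1

/-- This lets thin sets of matrices `W` pull back to thin sets of tuples of vectors. -/
theorem dftColumns_surjective : Function.Surjective (dftColumns N) := by
  intro W
  choose v hv using fun i ↦
    Matrix.mulVec_surjective_iff_isUnit.2 (isUnit_dftMatrix N) fun k ↦ W (k, i)
  exact ⟨fun q ↦ v q.1 q.2, funext fun q ↦ congrFun (hv q.2) q.1⟩

/-- The Fourier transforms of the vectors of a basis, as the columns of a matrix. -/
noncomputable def basisDft (V : OrderedBasis N) : Fin N × Fin N → ℂ :=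
  dftColumns N fun q ↦ V q.1 q.2

theorem powerSpectrum_apply (V : OrderedBasis N) (x : Fin N → ℂ) (k : Fin N) :
    powerSpectrum x k = ‖∑ i, V.equivFun x i * basisDft V (k, i)‖ ^ 2 := by
  have hx : dftMatrix N *ᵥ x = ∑ i, V.equivFun x i • (dftMatrix N *ᵥ V i) := by
    conv_lhs => rw [← V.sum_equivFun x]
    rw [Matrix.mulVec_sum]
    exact Finset.sum_congr rfl fun i _ ↦ Matrix.mulVec_smul _ _ _
  rw [powerSpectrum, hx, Finset.sum_apply]
  rfl

theorem norm_sum_eq_of_powerSpectrum_eq (V : OrderedBasis N) {x y : Fin N → ℂ}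
    (h : powerSpectrum x = powerSpectrum y) (k : Fin N) :
    ‖∑ i, V.equivFun x i * basisDft V (k, i)‖ = ‖∑ i, V.equivFun y i * basisDft V (k, i)‖ := by
  have := congrFun h k
  rw [powerSpectrum_apply V, powerSpectrum_apply V] at this
  exact (sq_eq_sq₀ (norm_nonneg _) (norm_nonneg _)).1 this

theorem mem_sparseSpan_iff (V : OrderedBasis N) {S : Finset (Fin N)} {x : Fin N → ℂ} :
    x ∈ sparseSpan V S ↔ ∀ i ∉ S, V.equivFun x i = 0 := by
  rw [sparseSpan, Module.Basis.mem_span_image]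
  simp only [Set.subset_def, Finset.mem_coe, Finsupp.mem_support_iff, Module.Basis.equivFun_apply]
  exact forall_congr' fun i ↦ not_imp_comm

end Fourier

/-! ### The conditions outside thin sets. -/

section Injectivity

variable {N : ℕ}

/-- Outside a thin set, the power spectrum determines sparse vectors up to a phase. -/
theorem exists_isThin_eqUpToPhase {M : ℕ} (h : 4 * M < N + 3) :
    ∃ A : Set (Fin N × Fin N → ℂ), IsThin A ∧ ∀ V : OrderedBasis N,
      (fun q : Fin N × Fin N ↦ V q.1 q.2) ∉ A → ∀ S₁ S₂ : Finset (Fin N), S₁.card = M →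
      S₂.card = M → ∀ x ∈ sparseSpan V S₁, ∀ y ∈ sparseSpan V S₂,
      powerSpectrum x = powerSpectrum y → EqUpToPhase x y := by
  let I := {q : (Finset (Fin N) × Finset (Fin N)) × (Fin N × Fin N) //
    q.1.1.card = M ∧ q.1.2.card = M ∧ q.2.1 ∈ q.1.1 ∧ q.2.2 ∈ q.1.2}
  let L : (Fin N × Fin N → ℂ) →ₗ[ℂ] (Empty ⊕ Fin N × Fin N → ℂ) :=
    (LinearMap.funLeft ℂ ℂ (Equiv.emptySum Empty (Fin N × Fin N))).comp (dftColumns N)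
  have hL : Function.Surjective L :=
    (LinearMap.funLeft_surjective_of_injective ℂ ℂ _ (Equiv.injective _)).comp
      dftColumns_surjective
  -- The parameters number `2(M - 1)` for `a`, whose entry at the first marked index is fixed to 1,
  -- and `2M - 1` for `b`, whose entry at the second is real.
  refine ⟨_, isThin_iUnion fun q : I ↦ (isThin_unresolved_pairs (κ := Fin N)
    (q.1.1.1.erase q.1.2.1) (q.1.1.1.erase q.1.2.1) q.1.1.2 (q.1.1.2.erase q.1.2.2)
    (Pi.single q.1.2.1 1) Empty.elim ?_).preimage L hL, ?_⟩
  · obtain ⟨q, h1, h2, h3, h4⟩ := q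
    have : 0 < q.1.1.card := Finset.card_pos.2 ⟨_, h3⟩
    simp only [Finset.card_erase_of_mem h3, Finset.card_erase_of_mem h4, h1, h2,
      Fintype.card_empty, Fintype.card_fin]
    omega
  intro V hV S₁ S₂ hS₁ hS₂ x hx y hy hxy
  by_contra hne
  set a := V.equivFun x with ha
  set b := V.equivFun y with hb
  obtain ⟨i₀, hi₀⟩ : ∃ i, a i ≠ 0 := by
    by_contra! h0
    have hx0 : x = 0 := V.equivFun.map_eq_zero_iff.1 (funext h0)
    have hy0 : y = 0 := eq_zero_of_powerSpectrum_eq_zero (by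
      rw [← hxy, hx0]; ext; simp [powerSpectrum])
    exact hne ⟨1, norm_one, by simp [hx0, hy0]⟩
  have hiS : i₀ ∈ S₁ := by
    by_contra hi
    exact hi₀ ((mem_sparseSpan_iff V).1 hx i₀ hi)
  obtain ⟨j₀, hj₀⟩ : S₂.Nonempty := Finset.card_pos.1 (by
    rw [hS₂, ← hS₁]; exact Finset.card_pos.2 ⟨i₀, hiS⟩)
  obtain ⟨t, ht, htb⟩ := exists_phase_mul_im_eq_zero (b j₀ / a i₀)
  have hfix : ∀ i ∉ S₁.erase i₀, a i / a i₀ = (Pi.single i₀ 1 : Fin N → ℂ) i := by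
    intro i hi
    by_cases hii : i = i₀
    · rw [hii, div_self hi₀, Pi.single_eq_same]
    · have : i ∉ S₁ := fun hiS ↦ hi (Finset.mem_erase.2 ⟨hii, hiS⟩)
      rw [Pi.single_eq_of_ne hii, show a i = 0 from (mem_sparseSpan_iff V).1 hx i this, zero_div]
  refine hV (Set.mem_iUnion.2 ⟨⟨((S₁, S₂), (i₀, j₀)), hS₁, hS₂, hiS, hj₀⟩,
    fun i ↦ a i / a i₀, fun i ↦ t * (b i / a i₀), fun i hi ↦ congrArg Complex.re (hfix i hi),
    fun i hi ↦ congrArg Complex.im (hfix i hi), ?_, ?_, fun j ↦ j.elim, ?_, ?_⟩)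
  · intro i hi
    simp [show b i = 0 from (mem_sparseSpan_iff V).1 hy i hi]
  · intro i hi
    by_cases hij : i = j₀
    · rw [hij]; exact htb
    · have : i ∉ S₂ := fun hiS ↦ hi (Finset.mem_erase.2 ⟨hij, hiS⟩)
      simp [show b i = 0 from (mem_sparseSpan_iff V).1 hy i this]
  · intro k
    change ‖∑ i, a i / a i₀ * basisDft V (k, i)‖ = ‖∑ i, t * (b i / a i₀) * basisDft V (k, i)‖
    simp only [div_mul_eq_mul_div, mul_assoc, ← Finset.sum_div, ← Finset.mul_sum, norm_div,
      norm_mul, ht, one_mul, ha, hb, norm_sum_eq_of_powerSpectrum_eq V hxy k]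
  · rintro ⟨s, hs, hab⟩
    refine hne ⟨s * t, by rw [norm_mul, hs, ht, one_mul], ?_⟩
    apply V.equivFun.injective
    rw [map_smul]
    ext i
    have := congrFun hab i
    simp only [Pi.smul_apply, smul_eq_mul] at this ⊢
    rw [← ha, ← hb]
    field_simp at this
    rw [this]

/-- Outside a thin set, condition (SR1g) holds. -/
theorem exists_isThin_sr1g {M : ℕ} (h : 2 * M < N + 1) :
    ∃ A : Set (Fin N × Fin N → ℂ), IsThin A ∧ ∀ V : OrderedBasis N,
      (fun q : Fin N × Fin N ↦ V q.1 q.2) ∉ A → SR1g M V := by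
  let I := {q : Finset (Fin N) × Fin N // q.1.card = M ∧ q.2 ∈ q.1}
  -- All entries of `a` on `S` are data here, so only the phase of `b` is normalised: the count is
  -- `4M - 1 < 2M + N`.
  refine ⟨_, isThin_iUnion fun q : I ↦ (isThin_unresolved_pairs (κ := Fin N) (ε := q.1.1)
    q.1.1 q.1.1 q.1.1 (q.1.1.erase q.1.2) 0 Subtype.val ?_).sections.preimage
      (dftColumns N) dftColumns_surjective, ?_⟩
  · obtain ⟨q, h1, h2⟩ := q
    have : 0 < q.1.card := Finset.card_pos.2 ⟨_, h2⟩
    simp only [Finset.card_erase_of_mem h2, h1, Fintype.card_coe, Fintype.card_fin]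
    omega
  intro V hV S hS
  rcases S.eq_empty_or_nonempty with rfl | ⟨j₀, hj₀⟩
  · refine ⟨_, isRealAlgebraic_zeros 1, ⟨0, by simp⟩, fun x _ y hy ↦
      ⟨fun _ ↦ ⟨1, norm_one, ?_⟩, EqUpToPhase.powerSpectrum_eq⟩⟩
    have hzero : ∀ z ∈ sparseSpan V ∅, z = 0 := fun z hz ↦ by simpa [sparseSpan] using hz
    rw [hzero _ x.2, hzero y hy, smul_zero]
  obtain ⟨p, hp, hpz⟩ := not_not.1 fun hbad ↦
    hV (Set.mem_iUnion.2 ⟨⟨(S, j₀), hS, hj₀⟩, hbad⟩)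
  -- `p` lives on the coefficients over `S`, while genericity is measured in ambient coordinates;
  -- `L` translates.
  let L : (Fin N → ℂ) →ₗ[ℂ] (S → ℂ) :=
    (LinearMap.funLeft ℂ ℂ Subtype.val).comp V.equivFun.toLinearMap
  obtain ⟨q, hq⟩ := exists_eval_realCoords_comp L p
  refine ⟨_, isRealAlgebraic_zeros q, ?_, fun x hx y hy ↦
    ⟨fun hxy ↦ ?_, EqUpToPhase.powerSpectrum_eq⟩⟩
  · obtain ⟨z, hz⟩ := exists_eval_realCoords_ne_zero hp
    let x := V.equivFun.symm fun i ↦ if h : i ∈ S then z ⟨i, h⟩ else 0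
    have hx : V.equivFun x = fun i ↦ if h : i ∈ S then z ⟨i, h⟩ else 0 :=
      V.equivFun.apply_symm_apply _
    have hLx : L x = z := by
      ext i
      change V.equivFun x i = z i
      simp [hx]
    refine ⟨⟨x, (mem_sparseSpan_iff V).2 fun i hi ↦ by simp [hx, hi]⟩, ?_⟩
    simpa [hq, hLx] using hz
  · by_contra hne
    refine hx ?_
    change eval (realCoords x.1) q = 0
    rw [hq]
    obtain ⟨t, ht, htb⟩ := exists_phase_mul_im_eq_zero (V.equivFun y j₀)
    refine hpz _ ⟨V.equivFun x, t • V.equivFun y, ?_, ?_, ?_, ?_, fun j ↦ rfl, ?_, ?_⟩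
    · intro i hi
      simp only [(mem_sparseSpan_iff V).1 x.2 i hi, Pi.zero_apply]
    · intro i hi
      simp only [(mem_sparseSpan_iff V).1 x.2 i hi, Pi.zero_apply]
    · intro i hi
      rw [Pi.smul_apply, (mem_sparseSpan_iff V).1 hy i hi, smul_zero, Complex.zero_re]
    · intro i hi
      by_cases hij : i = j₀
      · rw [hij]; exact htb
      · have : i ∉ S := fun hiS ↦ hi (Finset.mem_erase.2 ⟨hij, hiS⟩)
        rw [Pi.smul_apply, (mem_sparseSpan_iff V).1 hy i this, smul_zero, Complex.zero_im]
    · intro k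
      have hxy' : powerSpectrum x.1 = powerSpectrum (t • y) := by rw [powerSpectrum_smul ht, hxy]
      rw [← map_smul]
      exact norm_sum_eq_of_powerSpectrum_eq V hxy' k
    · rintro ⟨s, hs, hab⟩
      refine hne ⟨s * t, by rw [norm_mul, hs, ht, one_mul], ?_⟩
      apply V.equivFun.injective
      rw [hab, map_smul, mul_smul]

/-- Outside a thin set, condition (SR2g) holds. -/
theorem exists_isThin_sr2g {M : ℕ} (h : 2 * M < N + 1) :
    ∃ A : Set (Fin N × Fin N → ℂ), IsThin A ∧ ∀ V : OrderedBasis N,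
      (fun q : Fin N × Fin N ↦ V q.1 q.2) ∉ A → SR2g M V := by
  let I := {q : Finset (Fin N) × (Fin N × Fin N) // q.1.card = M ∧ q.2.1 ∉ q.1 ∧ q.2.2 ∈ q.1}
  refine ⟨_, isThin_iUnion fun q : I ↦ (isThin_spectrum_not_separated (κ := Fin N)
    q.2.2.1 q.2.2.2 ?_).preimage (dftColumns N) dftColumns_surjective, ?_⟩
  · have : 0 < q.1.1.card := Finset.card_pos.2 ⟨_, q.2.2.2⟩
    rw [q.2.1, Fintype.card_fin]
    have := q.2.1
    omega
  intro V hV S₁ S₂ hne hS₁ hS₂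
  obtain ⟨j, hj₁, hj₂⟩ : ∃ j ∈ S₁, j ∉ S₂ := by
    by_contra! hsub
    exact hne (Finset.eq_of_subset_of_card_le hsub (by rw [hS₁, hS₂]))
  obtain ⟨j₀, hj₀⟩ : S₂.Nonempty := Finset.card_pos.1 (by
    rw [hS₂, ← hS₁]; exact Finset.card_pos.2 ⟨j, hj₁⟩)
  obtain ⟨p, hp, hpj⟩ := not_not.1 fun hbad ↦
    hV (Set.mem_iUnion.2 ⟨⟨(S₂, (j, j₀)), hS₂, hj₂, hj₀⟩, hbad⟩)
  refine ⟨_, isRealAlgebraic_zeros p, ?_, fun hsub ↦ hpj ?_⟩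
  · rintro _ ⟨-, y, hy, rfl⟩
    have := hp (V.equivFun y) fun i hi ↦ (mem_sparseSpan_iff V).1 hy i hi
    rw [← this]
    change eval (powerSpectrum y) p = _
    congr 2
    ext k
    exact powerSpectrum_apply V y k
  -- The basis vector `V j`, with `j` in `S₁` but not in `S₂`, has a spectrum off the hypersurface.
  · exact hsub ⟨V j, Submodule.subset_span ⟨j, hj₁, rfl⟩, rfl⟩

end Injectivity

end PowerSpectrum

theorem mainTheorem2 (N M : ℕ) :
    ((N : ℤ) > 4 * (M : ℤ) - 3 →
      PowerSpectrum.HoldsGenerically PowerSpectrum.basisCoords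
        (fun V : PowerSpectrum.OrderedBasis N =>
          PowerSpectrum.SR1 M V ∧ PowerSpectrum.SR2 M V)) ∧
    ((N : ℤ) > 2 * (M : ℤ) - 1 →
      PowerSpectrum.HoldsGenerically PowerSpectrum.basisCoords
        (fun V : PowerSpectrum.OrderedBasis N =>
          PowerSpectrum.SR1g M V ∧ PowerSpectrum.SR2g M V)) := by
  refine ⟨fun h ↦ ?_, fun h ↦ ?_⟩
  · obtain ⟨A, hA, hphase⟩ := PowerSpectrum.exists_isThin_eqUpToPhase (N := N) (M := M) (by omega)
    refine PowerSpectrum.holdsGenerically_of_isThin hA fun V hV ↦ ⟨fun S hS x hx y hy ↦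
      ⟨hphase V hV S S hS hS x hx y hy, PowerSpectrum.EqUpToPhase.powerSpectrum_eq⟩,
      fun S₁ S₂ _ hS₁ hS₂ ↦ Set.Subset.antisymm ?_ (Set.image_inter_subset _ _ _)⟩
    rintro _ ⟨⟨x, hx, rfl⟩, y, hy, hxy⟩
    -- Being a multiple of `y`, the vector `x` lies in both spans.
    obtain ⟨t, -, rfl⟩ := hphase V hV S₁ S₂ hS₁ hS₂ x hx y hy hxy.symm
    exact ⟨t • y, ⟨hx, Submodule.smul_mem _ t hy⟩, rfl⟩
  · obtain ⟨A, hA, hA'⟩ := PowerSpectrum.exists_isThin_sr1g (N := N) (M := M) (by omega)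
    obtain ⟨B, hB, hB'⟩ := PowerSpectrum.exists_isThin_sr2g (N := N) (M := M) (by omega)
    exact PowerSpectrum.holdsGenerically_of_isThin (hA.union hB) fun V hV ↦
      ⟨hA' V fun hVA ↦ hV (Or.inl hVA), hB' V fun hVB ↦ hV (Or.inr hVB)⟩
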